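/- Let $F=F(X)$ be a non-abelian free group on a countable (finite or countably infinite) set $X$, and let $F_2=F(a,b)$ be the free group of rank $2$. For a family $(w_i)_{i\in I}$ generating a subgroup $L\leqslant F_2$, the Stallings folding $\Gamma_L$ of $L$ is obtained as follows: take for each $i$ a cycle of length $|w_i|$, glue all these cycles together at one vertex, and label the edges of the $i$-th cycle by the successive letters of the reduced word $w_i$, read from the common vertex (a letter $x^{-1}$ being an edge labelled $x\in\{a,b\}$ that is traversed against its direction); then repeatedly identify pairs of edges that have the same label and the same initial vertex or the same terminal vertex, until no such pair is left (if $I$ is infinite, make all the identifications so forced). The degree of a vertex of $\Gamma_L$ is the number of outgoing plus the number of incoming edges, a branch vertex is a vertex of degree at least $3$, and the (local) type of a vertex is the set of the labels of its incident edges together with their directions (outgoing or incoming). Then there is a monomorphism $\phi_0:F\to F_2$ such that for all subgroups $H,K\leqslant F$, every branch vertex of the foldings $\Gamma_{H^{\phi_0}}$ and $\Gamma_{K^{\phi_0}}$ (formed from any generating families of $H^{\phi_0}$ and $K^{\phi_0}$) has degree $3$, and all the vertices of degree $3$ of these two foldings have the same type. Moreover, for every choice of pairwise distinct positive integers $i(x)$,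 $x\in X$, one can take for $\phi_0$ the composition of the homomorphism $\psi:F\to F_2$, $x\mapsto a^{i(x)}\,b\,a^{i(x)}$, followed by the endomorphism $a\mapsto a^2$, $b\mapsto[a,b]=aba^{-1}b^{-1}$ of $F_2$. -/

import Mathlib

universe u v w

/-- A directed multigraph with edges labelled by elements of `A` and a distinguished vertex. -/
structure LabelledGraph (A : Type u) where
  /-- the vertices -/
  V : Type v
  /-- the edges -/
  E : Type w
  /-- the initial vertex of an edge -/
  tail : E → V
  /-- the terminal vertex of an edge -/
  head : E → V
  /-- the label of an edge -/
  label : E → A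
  /-- the distinguished vertex -/
  base : V

namespace LabelledGraph

variable {A : Type u}

/-- The undirected degree of a vertex: the number of outgoing edges plus the number of incoming
edges (so a loop counts twice). -/
noncomputable def degree (G : LabelledGraph.{u, v, w} A) (p : G.V) : ℕ∞ :=
  {e : G.E | G.tail e = p}.encard + {e : G.E | G.head e = p}.encard

/-- A branch vertex is a vertex of degree at least three. -/
def IsBranch (G : LabelledGraph.{u, v, w} A) (p : G.V) : Prop := 3 ≤ G.degree p

/-- The local type of a vertex: the labels of the incident edges together with their directions,
`(x, true)` standing for an outgoing and `(x, false)` for an incoming edge with label `x`. -/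
def localType (G : LabelledGraph.{u, v, w} A) (p : G.V) : Set (A × Bool) :=
  {s | (s.2 = true ∧ ∃ e, G.tail e = p ∧ G.label e = s.1) ∨
    (s.2 = false ∧ ∃ e, G.head e = p ∧ G.label e = s.1)}

/-- The identifications of vertices that are forced by repeatedly identifying two edges which
carry the same label and which have the same tail or the same head (up to the identifications
made before). When two edges are identified, so are their tails and their heads. -/
inductive FoldRel (G : LabelledGraph.{u, v, w} A) : G.V → G.V → Prop
  | refl (p : G.V) : FoldRel G p p
  | symm {p q : G.V} : FoldRel G p q → FoldRel G q p
  | trans {p q r : G.V} : FoldRel G p q → FoldRel G q r → FoldRel G p r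
  | foldHead {e f : G.E} : G.label e = G.label f → FoldRel G (G.tail e) (G.tail f) →
      FoldRel G (G.head e) (G.head f)
  | foldTail {e f : G.E} : G.label e = G.label f → FoldRel G (G.head e) (G.head f) →
      FoldRel G (G.tail e) (G.tail f)

/-- Two vertices are equivalent when they are identified by the folding process. -/
def vertexSetoid (G : LabelledGraph.{u, v, w} A) : Setoid G.V where
  r := G.FoldRel
  iseqv := ⟨FoldRel.refl, FoldRel.symm, FoldRel.trans⟩

/-- Two edges are equivalent when they are identified by the folding process: they have the same
label, and their tails or their heads are identified. -/
def edgeSetoid (G : LabelledGraph.{u, v, w} A) : Setoid G.E where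
  r e f := G.label e = G.label f ∧
    (G.FoldRel (G.tail e) (G.tail f) ∨ G.FoldRel (G.head e) (G.head f))
  iseqv := by
    have key : ∀ {e f : G.E}, G.label e = G.label f →
        (G.FoldRel (G.tail e) (G.tail f) ∨ G.FoldRel (G.head e) (G.head f)) →
        G.FoldRel (G.tail e) (G.tail f) := by
      intro e f h h'
      exact h'.elim id (FoldRel.foldTail h)
    refine ⟨fun e => ⟨rfl, Or.inl (FoldRel.refl _)⟩, ?_, ?_⟩
    · rintro e f ⟨h, h'⟩
      exact ⟨h.symm, Or.inl (key h h').symm⟩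
    · rintro e f g ⟨h, h'⟩ ⟨k, k'⟩
      exact ⟨h.trans k, Or.inl ((key h h').trans (key k k'))⟩

/-- The labelled graph that results from exhaustively folding `G`. -/
def fold (G : LabelledGraph.{u, v, w} A) : LabelledGraph.{u, v, w} A where
  V := Quotient G.vertexSetoid
  E := Quotient G.edgeSetoid
  tail := Quotient.map G.tail (fun _ _ h => h.2.elim id (FoldRel.foldTail h.1))
  head := Quotient.map G.head (fun _ _ h => h.2.elim (FoldRel.foldHead h.1) id)
  label := Quotient.lift G.label (fun _ _ h => h.1)
  base := Quotient.mk _ G.base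

/-- The rose of a family of elements `g i` of the free group on `A`: for each `i` a cycle of
length `|g i|`, all the cycles having one vertex in common, which is the base vertex `none`. The
other vertices of the `i`-th cycle are `(i, k)` with `0 < k < |g i|`, its edges are numbered by
`0 ≤ k < |g i|`. The letters of the reduced word `g i` are read along the cycle from the base
vertex: a letter `x` (that is, `(x, true)`) is an edge with label `x` in the direction of reading,
a letter `x⁻¹` (that is, `(x, false)`) an edge with label `x` in the opposite direction. -/
def rose [DecidableEq A] {ι : Type v} (g : ι → FreeGroup A) : LabelledGraph.{u, v, v} A :=
  let pos : ι → ℕ → Option (Σ i : ι, {k : ℕ // 0 < k ∧ k < (g i).toWord.length}) :=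
    fun i k => if h : 0 < k ∧ k < (g i).toWord.length then some ⟨i, k, h⟩ else none
  { V := Option (Σ i : ι, {k : ℕ // 0 < k ∧ k < (g i).toWord.length})
    E := Σ i : ι, Fin (g i).toWord.length
    tail := fun e => if ((g e.1).toWord.get e.2).2 then pos e.1 e.2 else pos e.1 (e.2 + 1)
    head := fun e => if ((g e.1).toWord.get e.2).2 then pos e.1 (e.2 + 1) else pos e.1 e.2
    label := fun e => ((g e.1).toWord.get e.2).1
    base := none }

/-- The Stallings folding of the subgroup generated by the family `g`. -/
def stallings [DecidableEq A] {ι : Type v} (g : ι → FreeGroup A) : LabelledGraph.{u, v, v} A :=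
  (rose g).fold

end LabelledGraph

/-- The homomorphism from the free group on `X` to the free group on `a = 0`, `b = 1` that maps
the generator `x` with number `i = idx x` to `a ^ i * b * a ^ i`. -/
def psiHom {X : Type u} (idx : X → ℕ) : FreeGroup X →* FreeGroup (Fin 2) :=
  FreeGroup.lift fun x =>
    FreeGroup.of 0 ^ idx x * FreeGroup.of 1 * FreeGroup.of 0 ^ idx x

/-- The endomorphism `a ↦ a ^ 2`, `b ↦ a * b * a⁻¹ * b⁻¹` of the free group on
`a = 0`, `b = 1`. -/
def squareCommHom : FreeGroup (Fin 2) →* FreeGroup (Fin 2) :=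
  FreeGroup.lift ![FreeGroup.of 0 ^ 2, FreeGroup.of 0 * FreeGroup.of 1 * (FreeGroup.of 0)⁻¹ * (FreeGroup.of 1)⁻¹]

/-- For all subgroups `H`, `K` of the source of `φ`, in the foldings of the images of `H` and `K`
under `φ` (formed from any generating families of these images) every branch vertex has degree 3,
and all the vertices of degree 3 have one and the same local type. -/
def HasUniformFoldings {F : Type u} [Group F] (φ : F →* FreeGroup (Fin 2)) : Prop :=
  ∀ (H K : Subgroup F) (ι κ : Type v)
    (g : ι → FreeGroup (Fin 2)) (k : κ → FreeGroup (Fin 2)),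
    Subgroup.closure (Set.range g) = H.map φ →
    Subgroup.closure (Set.range k) = K.map φ →
    (∀ p, (LabelledGraph.stallings g).IsBranch p → (LabelledGraph.stallings g).degree p = 3) ∧
    (∀ p, (LabelledGraph.stallings k).IsBranch p → (LabelledGraph.stallings k).degree p = 3) ∧
    ∃ τ : Set (Fin 2 × Bool),
      (∀ p, (LabelledGraph.stallings g).degree p = 3 →
        (LabelledGraph.stallings g).localType p = τ) ∧
      (∀ p, (LabelledGraph.stallings k).degree p = 3 →
        (LabelledGraph.stallings k).localType p = τ)

/-!
Both halves of the statement follow from one device, a graph `E` with edges labelled by `A` and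
weighted by elements of a group `G` which is folded (`IsFolded`): an edge is determined by its label
and either of its ends. If a homomorphism `f : FreeGroup X →* FreeGroup A` sends every generator `x`
to an element that is read by a loop of weight `x` at a vertex `o`, then, since cancelling `y y⁻¹`
in a word changes neither the ends nor the weight of the path reading it, the reduced word of each
`f g` is read by a loop of weight `g` at `o` (`reads_toWord_map`). In a folded graph the weight is a
function of the word, so `f` is injective (`injective_of_reads`).

* For `psiHom idx` the graph has vertex set `ℤ`, edges `n → n + 1` of label `a` and weight `1`, and
  for each `x` an edge `idx x → -idx x` of label `b` and weight `x`. It is folded because `idx` is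
  injective.
* For `squareCommHom` it is the folding of `⟨a ^ 2, [a, b]⟩`, which has four vertices `p₀`, `p₁`,
  `q₀`, `q₁`: the edges are `p₀ → p₁ → p₀` and `q₁ → q₀` of label `a`, and `p₁ → q₀` and `p₀ → q₁`
  of label `b`. The types of `p₀` and `p₁` are both `{a out, a in, b out}`, and `q₀`, `q₁` have
  degree two.

If all `g i` lie in the image of `squareCommHom`, the rose of `g` maps to this second graph, hence
so does its folding (`FoldRel.map_eq`). A folding is folded, so the degree of a vertex is the
cardinality of its type (`degree_fold`), and the type of a vertex is contained in the type of its
image. So a vertex of degree at least three lies over `p₀` or `p₁`, and its type is the common type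
of these two.
-/

/-! ### Weighted folded graphs -/

section WeightedGraph

variable {S A X G : Type*}

/-- `E s x t g` says that there is an edge from `s` to `t` of label `x` and weight `g`. The graph
`E` is folded if an edge, together with its weight, is determined by its label and its initial
vertex, and also by its label and its terminal vertex. -/
structure IsFolded (E : S → A → S → G → Prop) : Prop where
  out : ∀ {s x t t' g g'}, E s x t g → E s x t' g' → t = t' ∧ g = g'
  into : ∀ {s s' x t g g'}, E s x t g → E s' x t g' → s = s' ∧ g = g'

variable [Group G]

/-- `Traverses E s l t g`: the letter `l` is read by traversing an edge of `E` from `s` to `t`, with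
weight `g`; a letter `(x, false)` traverses an edge against its direction and inverts its weight. -/
def Traverses (E : S → A → S → G → Prop) : S → A × Bool → S → G → Prop
  | s, (x, true), t, g => E s x t g
  | s, (x, false), t, g => E t x s g⁻¹

/-- `Reads E s w g t`: some path of `E` from `s` to `t` reads the (not necessarily reduced) word
`w`, and the product of the weights along it is `g`. -/
inductive Reads (E : S → A → S → G → Prop) : S → List (A × Bool) → G → S → Prop
  | nil (s : S) : Reads E s [] 1 s
  | cons {s t u : S} {l : A × Bool} {w : List (A × Bool)} {g h : G} :
      Traverses E s l t g → Reads E t w h u → Reads E s (l :: w) (g * h) u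

variable {E : S → A → S → G → Prop}

theorem Traverses.inv {s t : S} {l : A × Bool} {g : G} (h : Traverses E s l t g) :
    Traverses E t (l.1, !l.2) s g⁻¹ := by
  obtain ⟨x, _ | _⟩ := l
  · exact h
  · simpa [Traverses] using h

theorem Traverses.unique (hE : IsFolded E) {s t t' : S} {l : A × Bool} {g g' : G}
    (h : Traverses E s l t g) (h' : Traverses E s l t' g') : t = t' ∧ g = g' := by
  obtain ⟨x, _ | _⟩ := l
  · exact (hE.into h h').imp_right inv_injective.eq_iff.mp
  · exact hE.out h h'

theorem Reads.append {s t u : S} {w w' : List (A × Bool)} {g h : G}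
    (hw : Reads E s w g t) (hw' : Reads E t w' h u) : Reads E s (w ++ w') (g * h) u := by
  induction hw with
  | nil => simpa using hw'
  | cons hl _ ih => rw [mul_assoc]; exact .cons hl (ih hw')

theorem Reads.single {s t : S} {l : A × Bool} {g : G} (h : Traverses E s l t g) :
    Reads E s [l] g t := by
  simpa using Reads.cons h (.nil t)

theorem Reads.inv {s t : S} {w : List (A × Bool)} {g : G} (h : Reads E s w g t) :
    Reads E t (FreeGroup.invRev w) g⁻¹ s := by
  induction h with
  | nil s => simpa using Reads.nil s
  | cons hl _ ih =>
    rw [mul_inv_rev]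
    simpa [FreeGroup.invRev] using ih.append (.single hl.inv)

theorem Reads.split {s u : S} {w w' : List (A × Bool)} {g : G} (h : Reads E s (w ++ w') g u) :
    ∃ t g₁ g₂, g = g₁ * g₂ ∧ Reads E s w g₁ t ∧ Reads E t w' g₂ u := by
  induction w generalizing s g with
  | nil => exact ⟨s, 1, g, by simp, .nil s, h⟩
  | cons l w ih =>
    cases h with
    | cons hl hw =>
      obtain ⟨t, g₁, g₂, rfl, h₁, h₂⟩ := ih hw
      exact ⟨t, _, g₂, by rw [mul_assoc], .cons hl h₁, h₂⟩

theorem Reads.red (hE : IsFolded E) {s t : S} {w w' : List (A × Bool)} {g : G}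
    (h : Reads E s w g t) (hw : FreeGroup.Red w w') : Reads E s w' g t := by
  induction hw with
  | refl => exact h
  | tail _ hstep ih =>
    cases hstep with
    | not =>
      obtain ⟨r, g₁, g₂, rfl, h₁, h₂⟩ := ih.split
      cases h₂ with
      | cons hl h₃ =>
        cases h₃ with
        | cons hl' h₄ =>
          -- By foldedness the second edge traverses the first one backwards.
          obtain ⟨rfl, rfl⟩ := hl.inv.unique hE hl'
          simpa using h₁.append h₄

theorem Reads.weight_unique (hE : IsFolded E) {s t t' : S} {w : List (A × Bool)} {g g' : G}
    (h : Reads E s w g t) (h' : Reads E s w g' t') : g = g' := by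
  induction h generalizing g' with
  | nil => cases h'; rfl
  | cons hl _ ih =>
    cases h' with
    | cons hl' hw' =>
      obtain ⟨rfl, rfl⟩ := hl.unique hE hl'
      rw [ih hw']

theorem Reads.exists_vertices {s t : S} {w : List (A × Bool)} {g : G} (h : Reads E s w g t) :
    ∃ σ : ℕ → S, σ 0 = s ∧ σ w.length = t ∧
      ∀ k : Fin w.length, ∃ g, Traverses E (σ k) (w.get k) (σ (k + 1)) g := by
  induction h with
  | nil s => exact ⟨fun _ => s, rfl, rfl, fun k => k.elim0⟩
  | @cons s t u l w g h hl _ ih =>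
    obtain ⟨σ, h₀, h₁, hσ⟩ := ih
    refine ⟨fun k => Nat.casesOn k s σ, rfl, h₁, Fin.cases ?_ fun k => ?_⟩
    · exact ⟨g, by simpa [h₀] using hl⟩
    · simpa using hσ k

/-- If every generator `x` is mapped to an element read by a loop of weight `x`, the reduced word of
the image of `g` is read by a loop of weight `g`. -/
theorem reads_toWord_map [DecidableEq A] {E : S → A → S → FreeGroup X → Prop} (hE : IsFolded E)
    {f : FreeGroup X →* FreeGroup A} {o : S}
    (hf : ∀ x, ∃ w, FreeGroup.mk w = f (.of x) ∧ Reads E o w (.of x) o) (g : FreeGroup X) :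
    Reads E o (f g).toWord g o := by
  suffices ∃ w, FreeGroup.mk w = f g ∧ Reads E o w g o by
    obtain ⟨w, hw, h⟩ := this
    rw [← hw, FreeGroup.toWord_mk]
    exact h.red hE FreeGroup.reduce.red
  induction g using FreeGroup.induction_on with
  | C1 => exact ⟨[], (map_one f).symm, .nil o⟩
  | of x => exact hf x
  | inv_of x ih =>
    obtain ⟨w, hw, h⟩ := ih
    exact ⟨FreeGroup.invRev w, by rw [← FreeGroup.inv_mk, map_inv, ← hw], h.inv⟩
  | mul x y hx hy =>
    obtain ⟨w, hw, h⟩ := hx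
    obtain ⟨w', hw', h'⟩ := hy
    exact ⟨w ++ w', by rw [← FreeGroup.mul_mk, hw, hw', map_mul], h.append h'⟩

theorem injective_of_reads [DecidableEq A] {E : S → A → S → FreeGroup X → Prop} (hE : IsFolded E)
    {f : FreeGroup X →* FreeGroup A} {o : S}
    (hf : ∀ x, ∃ w, FreeGroup.mk w = f (.of x) ∧ Reads E o w (.of x) o) :
    Function.Injective f := by
  intro g h hgh
  have hg := reads_toWord_map hE hf g
  rw [hgh] at hg
  exact hg.weight_unique hE (reads_toWord_map hE hf h)

end WeightedGraph

/-! ### Degrees and types in foldings -/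

namespace LabelledGraph

variable {A : Type u}

theorem fold_tail_injOn (G : LabelledGraph.{u, v, w} A) (p : G.fold.V) :
    Set.InjOn G.fold.label {e | G.fold.tail e = p} := by
  rintro ⟨e⟩ he ⟨f⟩ hf hl
  exact Quotient.sound ⟨hl, Or.inl (Quotient.exact (he.trans hf.symm))⟩

theorem fold_head_injOn (G : LabelledGraph.{u, v, w} A) (p : G.fold.V) :
    Set.InjOn G.fold.label {e | G.fold.head e = p} := by
  rintro ⟨e⟩ he ⟨f⟩ hf hl
  exact Quotient.sound ⟨hl, Or.inr (Quotient.exact (he.trans hf.symm))⟩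

theorem degree_fold (G : LabelledGraph.{u, v, w} A) (p : G.fold.V) :
    G.fold.degree p = (G.fold.localType p).encard := by
  have h : G.fold.localType p =
      (fun x => (x, true)) '' (G.fold.label '' {e | G.fold.tail e = p}) ∪
      (fun x => (x, false)) '' (G.fold.label '' {e | G.fold.head e = p}) := by
    ext ⟨x, _ | _⟩ <;> simp [localType]
  rw [h, Set.encard_union_eq, (Prod.mk_left_injective true).encard_image,
    (Prod.mk_left_injective false).encard_image, (fold_tail_injOn G p).encard_image,
    (fold_head_injOn G p).encard_image, degree]
  rw [Set.disjoint_left]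
  rintro _ ⟨x, -, rfl⟩ ⟨y, -, hy⟩
  simp at hy

variable {S G : Type*} {E : S → A → S → G → Prop}

/-- Folding identifies only vertices with the same image under a morphism to a folded graph. -/
theorem FoldRel.map_eq (hE : IsFolded E) {Γ : LabelledGraph.{u, v, w} A} {f : Γ.V → S}
    (hf : ∀ e, ∃ g, E (f (Γ.tail e)) (Γ.label e) (f (Γ.head e)) g) {p q : Γ.V}
    (h : Γ.FoldRel p q) : f p = f q := by
  induction h with
  | refl => rfl
  | symm _ ih => exact ih.symm
  | trans _ _ ih ih' => exact ih.trans ih'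
  | @foldHead e e' hl _ ih =>
    obtain ⟨g, hg⟩ := hf e
    obtain ⟨g', hg'⟩ := hf e'
    rw [hl, ih] at hg
    exact (hE.out hg hg').1
  | @foldTail e e' hl _ ih =>
    obtain ⟨g, hg⟩ := hf e
    obtain ⟨g', hg'⟩ := hf e'
    rw [hl, ih] at hg
    exact (hE.into hg hg').1

variable [Group G]

theorem exists_traverses_of_mem_localType_fold (hE : IsFolded E) {Γ : LabelledGraph.{u, v, w} A}
    {f : Γ.V → S} (hf : ∀ e, ∃ g, E (f (Γ.tail e)) (Γ.label e) (f (Γ.head e)) g) (p : Γ.fold.V) :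
    ∃ s, ∀ l ∈ Γ.fold.localType p, ∃ t g, Traverses E s l t g := by
  obtain ⟨p⟩ := p
  refine ⟨f p, ?_⟩
  rintro ⟨x, b⟩ (⟨rfl, ⟨e⟩, he, rfl⟩ | ⟨rfl, ⟨e⟩, he, rfl⟩)
  · obtain ⟨g, hg⟩ := hf e
    rw [FoldRel.map_eq hE hf (Quotient.exact he)] at hg
    exact ⟨_, g, hg⟩
  · obtain ⟨g, hg⟩ := hf e
    rw [FoldRel.map_eq hE hf (Quotient.exact he)] at hg
    exact ⟨_, g⁻¹, (inv_inv g).symm ▸ hg⟩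

theorem exists_map_rose [DecidableEq A] {ι : Type v} (k : ι → FreeGroup A) {o : S}
    (hk : ∀ i, ∃ g, Reads E o (k i).toWord g o) :
    ∃ f : (rose k).V → S, ∀ e, ∃ g,
      E (f ((rose k).tail e)) ((rose k).label e) (f ((rose k).head e)) g := by
  choose σ h₀ h₁ hσ using fun i => (hk i).choose_spec.exists_vertices
  let pos : ∀ (i : ι) (n : ℕ), (rose k).V := fun i n =>
    if h : 0 < n ∧ n < (k i).toWord.length then some ⟨i, n, h⟩ else none
  let f : (rose k).V → S := fun p => Option.elim p o fun q => σ q.1 q.2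
  have hpos : ∀ i n, n ≤ (k i).toWord.length → σ i n = f (pos i n) := by
    intro i n hn
    by_cases h : 0 < n ∧ n < (k i).toWord.length
    · have hp : pos i n = some ⟨i, n, h⟩ := dif_pos h
      rw [hp]
      rfl
    · have hp : pos i n = none := dif_neg h
      rw [hp]
      -- Outside the open interval the position is an end of the cycle, that is, the base vertex.
      obtain rfl | rfl : n = 0 ∨ n = (k i).toWord.length := by omega
      · exact h₀ i
      · exact h₁ i
  refine ⟨f, fun ⟨i, n⟩ => ?_⟩
  obtain ⟨g, hg⟩ := hσ i n
  rw [hpos i n n.2.le, hpos i (n + 1) n.2] at hg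
  have htail : (rose k).tail ⟨i, n⟩ =
      if ((k i).toWord.get n).2 then pos i n else pos i (n + 1) := rfl
  have hhead : (rose k).head ⟨i, n⟩ =
      if ((k i).toWord.get n).2 then pos i (n + 1) else pos i n := rfl
  have hlabel : (rose k).label ⟨i, n⟩ = ((k i).toWord.get n).1 := rfl
  rw [htail, hhead, hlabel]
  generalize (k i).toWord.get n = l at hg
  obtain ⟨x, _ | _⟩ := l
  · exact ⟨g⁻¹, hg⟩
  · exact ⟨g, hg⟩

end LabelledGraph

/-! ### The homomorphism `a ↦ a ^ 2`, `b ↦ [a, b]` -/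

/-- The vertices of the folding of `⟨a ^ 2, [a, b]⟩`, named so that `a ^ 2` is read along
`p₀ p₁ p₀` and `[a, b]` along `p₀ p₁ q₀ q₁ p₀`. -/
inductive SquareCommVertex
  | p₀ | p₁ | q₀ | q₁

open SquareCommVertex in
/-- The folding of `⟨a ^ 2, [a, b]⟩`. All weights are trivial outside the last edge of the loop of
`a ^ 2` and the second edge of the loop of `[a, b]`, which carry the generators themselves. -/
inductive SquareCommEdge :
    SquareCommVertex → Fin 2 → SquareCommVertex → FreeGroup (Fin 2) → Prop
  | a₀ : SquareCommEdge p₀ 0 p₁ 1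
  | a₁ : SquareCommEdge p₁ 0 p₀ (.of 0)
  | a₂ : SquareCommEdge q₁ 0 q₀ 1
  | b₀ : SquareCommEdge p₀ 1 q₁ 1
  | b₁ : SquareCommEdge p₁ 1 q₀ (.of 1)

theorem isFolded_squareCommEdge : IsFolded SquareCommEdge where
  out h h' := by cases h <;> cases h' <;> exact ⟨rfl, rfl⟩
  into h h' := by cases h <;> cases h' <;> exact ⟨rfl, rfl⟩

theorem exists_reads_squareCommHom (x : Fin 2) :
    ∃ w, FreeGroup.mk w = squareCommHom (.of x) ∧ Reads SquareCommEdge .p₀ w (.of x) .p₀ := by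
  have hb₀ : Traverses SquareCommEdge .q₁ (1, false) .p₀ 1 := by
    simpa [Traverses] using SquareCommEdge.b₀
  have ha₂ : Traverses SquareCommEdge .q₀ (0, false) .q₁ 1 := by
    simpa [Traverses] using SquareCommEdge.a₂
  have ha₀ : Traverses SquareCommEdge .p₀ (0, true) .p₁ 1 := SquareCommEdge.a₀
  have ha₁ : Traverses SquareCommEdge .p₁ (0, true) .p₀ (.of 0) := SquareCommEdge.a₁
  have hb₁ : Traverses SquareCommEdge .p₁ (1, true) .q₀ (.of 1) := SquareCommEdge.b₁
  fin_cases x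
  · refine ⟨[(0, true), (0, true)], ?_, ?_⟩
    · simp [squareCommHom, pow_two]; rfl
    · simpa using Reads.cons ha₀ (.single ha₁)
  · refine ⟨[(0, true), (1, true), (0, false), (1, false)], ?_, ?_⟩
    · simp [squareCommHom]; rfl
    · simpa using Reads.cons ha₀ (.cons hb₁ (.cons ha₂ (.single hb₀)))

theorem squareCommHom_injective : Function.Injective squareCommHom :=
  injective_of_reads isFolded_squareCommEdge exists_reads_squareCommHom

/-- The first alternative holds at `p₀` and `p₁`, the second at `q₀` and `q₁`. -/
theorem subset_or_encard_le_of_traverses {s : SquareCommVertex} {T : Set (Fin 2 × Bool)}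
    (hT : ∀ l ∈ T, ∃ t g, Traverses SquareCommEdge s l t g) :
    T ⊆ {(0, true), (0, false), (1, true)} ∨ T.encard ≤ 2 := by
  have key : ∀ U : Set (Fin 2 × Bool), (∀ x t g, SquareCommEdge s x t g → (x, true) ∈ U) →
      (∀ x t g, SquareCommEdge t x s g → (x, false) ∈ U) → T ⊆ U := by
    rintro U h₁ h₂ ⟨x, _ | _⟩ hl <;> obtain ⟨t, g, h⟩ := hT _ hl
    · exact h₂ x t g⁻¹ h
    · exact h₁ x t g h
  cases s with
  | p₀ => left; apply key <;> rintro x t g ⟨⟩ <;> simp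
  | p₁ => left; apply key <;> rintro x t g ⟨⟩ <;> simp
  | q₀ =>
    right
    refine (Set.encard_le_encard (key {(0, false), (1, false)} ?_ ?_)).trans
      (Set.encard_pair (by simp)).le <;> rintro x t g ⟨⟩ <;> simp
  | q₁ =>
    right
    refine (Set.encard_le_encard (key {(0, true), (1, false)} ?_ ?_)).trans
      (Set.encard_pair (by simp)).le <;> rintro x t g ⟨⟩ <;> simp

/-- In the folding of any family in the image of `squareCommHom`, a branch vertex has degree three,
and a vertex of degree three has the type `{a out, a in, b out}`. -/
theorem stallings_of_mem_range_squareCommHom {ι : Type v} {k : ι → FreeGroup (Fin 2)}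
    (hk : ∀ i, k i ∈ squareCommHom.range) (p : (LabelledGraph.stallings k).V) :
    ((LabelledGraph.stallings k).IsBranch p → (LabelledGraph.stallings k).degree p = 3) ∧
    ((LabelledGraph.stallings k).degree p = 3 →
      (LabelledGraph.stallings k).localType p = {(0, true), (0, false), (1, true)}) := by
  obtain ⟨f, hf⟩ := LabelledGraph.exists_map_rose k (E := SquareCommEdge) (o := .p₀) fun i => by
    obtain ⟨g, hg⟩ := hk i
    exact ⟨g, hg ▸ reads_toWord_map isFolded_squareCommEdge exists_reads_squareCommHom g⟩
  obtain ⟨s, hs⟩ := LabelledGraph.exists_traverses_of_mem_localType_fold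
    isFolded_squareCommEdge hf p
  have hdeg : (LabelledGraph.stallings k).degree p =
      ((LabelledGraph.stallings k).localType p).encard := LabelledGraph.degree_fold _ p
  have h3 : ({(0, true), (0, false), (1, true)} : Set (Fin 2 × Bool)).encard = 3 :=
    Set.encard_eq_three.mpr ⟨_, _, _, by simp, by simp, by simp, rfl⟩
  rw [LabelledGraph.IsBranch, hdeg]
  rcases subset_or_encard_le_of_traverses hs with h | h
  · exact ⟨fun hp => le_antisymm (h3 ▸ Set.encard_le_encard h) hp,
      fun hp => (Set.toFinite _).eq_of_subset_of_encard_le h (by rw [h3]; exact hp.ge)⟩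
  · have h23 : ¬ (3 : ℕ∞) ≤ 2 := by decide
    exact ⟨fun hp => (h23 (hp.trans h)).elim, fun hp => (h23 (hp.ge.trans h)).elim⟩

theorem hasUniformFoldings_squareCommHom_comp {F : Type u} [Group F] (f : F →* FreeGroup (Fin 2)) :
    HasUniformFoldings.{u, v} (squareCommHom.comp f) := by
  intro H K ι κ g k hg hk
  have mem : ∀ {L : Subgroup F} {θ : Type v} {m : θ → FreeGroup (Fin 2)},
      Subgroup.closure (Set.range m) = L.map (squareCommHom.comp f) →
      ∀ i, m i ∈ squareCommHom.range := by
    intro L θ m hm i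
    have hi : m i ∈ L.map (squareCommHom.comp f) :=
      hm ▸ Subgroup.subset_closure (Set.mem_range_self i)
    obtain ⟨y, -, hy⟩ := hi
    exact ⟨f y, hy⟩
  exact ⟨fun p => (stallings_of_mem_range_squareCommHom (mem hg) p).1,
    fun p => (stallings_of_mem_range_squareCommHom (mem hk) p).1, _,
    fun p => (stallings_of_mem_range_squareCommHom (mem hg) p).2,
    fun p => (stallings_of_mem_range_squareCommHom (mem hk) p).2⟩

/-! ### The homomorphism `x ↦ a ^ i(x) b a ^ i(x)` -/

/-- The graph in which the image of `psiHom idx` is read at `0`: a line of `a`-edges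
through the integers, and for each generator `x` a `b`-edge from `idx x` to `-idx x`, whose weight
is `x`. -/
inductive PsiEdge {X : Type u} (idx : X → ℕ) : ℤ → Fin 2 → ℤ → FreeGroup X → Prop
  | a (n : ℤ) : PsiEdge idx n 0 (n + 1) 1
  | b (x : X) : PsiEdge idx (idx x) 1 (-idx x) (.of x)

theorem psiEdge_zero_iff {X : Type u} {idx : X → ℕ} {m n : ℤ} {g : FreeGroup X} :
    PsiEdge idx m 0 n g ↔ n = m + 1 ∧ g = 1 := by
  constructor
  · rintro ⟨⟩
    exact ⟨rfl, rfl⟩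
  · rintro ⟨rfl, rfl⟩
    exact .a m

theorem psiEdge_one_iff {X : Type u} {idx : X → ℕ} {m n : ℤ} {g : FreeGroup X} :
    PsiEdge idx m 1 n g ↔ ∃ x, m = idx x ∧ n = -idx x ∧ g = .of x := by
  constructor
  · rintro ⟨⟩
    exact ⟨_, rfl, rfl, rfl⟩
  · rintro ⟨x, rfl, rfl, rfl⟩
    exact .b x

theorem isFolded_psiEdge {X : Type u} {idx : X → ℕ} (hidx : Function.Injective idx) :
    IsFolded (PsiEdge idx) where
  out {s x t t' g g'} h h' := by
    obtain rfl | rfl : x = 0 ∨ x = 1 := by omega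
    · rw [psiEdge_zero_iff] at h h'
      exact ⟨h.1.trans h'.1.symm, h.2.trans h'.2.symm⟩
    · rw [psiEdge_one_iff] at h h'
      obtain ⟨y, rfl, rfl, rfl⟩ := h
      obtain ⟨z, hz, rfl, rfl⟩ := h'
      obtain rfl : y = z := hidx (by omega)
      exact ⟨rfl, rfl⟩
  into {s s' x t g g'} h h' := by
    obtain rfl | rfl : x = 0 ∨ x = 1 := by omega
    · rw [psiEdge_zero_iff] at h h'
      exact ⟨by omega, h.2.trans h'.2.symm⟩
    · rw [psiEdge_one_iff] at h h'
      obtain ⟨y, rfl, rfl, rfl⟩ := h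
      obtain ⟨z, rfl, hz, rfl⟩ := h'
      obtain rfl : y = z := hidx (by omega)
      exact ⟨rfl, rfl⟩

theorem reads_psiEdge_replicate {X : Type u} (idx : X → ℕ) (m : ℤ) (n : ℕ) :
    Reads (PsiEdge idx) m (List.replicate n (0, true)) 1 (m + n) := by
  induction n generalizing m with
  | zero => simpa using Reads.nil m
  | succ n ih =>
    have h : Traverses (PsiEdge idx) m (0, true) (m + 1) 1 := PsiEdge.a m
    have := Reads.cons h (ih (m + 1))
    rw [mul_one, add_assoc, add_comm 1 (n : ℤ)] at this
    exact_mod_cast this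

theorem exists_reads_psiHom {X : Type u} (idx : X → ℕ) (x : X) :
    ∃ w, FreeGroup.mk w = psiHom idx (.of x) ∧ Reads (PsiEdge idx) 0 w (.of x) 0 := by
  have hpow : ∀ n : ℕ, FreeGroup.mk (List.replicate n ((0 : Fin 2), true)) = .of 0 ^ n := by
    intro n
    induction n with
    | zero => rfl
    | succ n ih =>
      rw [pow_succ', ← ih]
      rfl
  refine ⟨List.replicate (idx x) (0, true) ++ [(1, true)] ++ List.replicate (idx x) (0, true),
    ?_, ?_⟩
  · rw [← FreeGroup.mul_mk, ← FreeGroup.mul_mk, hpow]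
    simp [psiHom]
    rfl
  · have hb : Traverses (PsiEdge idx) (idx x) (1, true) (-idx x) (.of x) := PsiEdge.b x
    have h₁ := reads_psiEdge_replicate idx 0 (idx x)
    have h₂ := reads_psiEdge_replicate idx (-idx x) (idx x)
    rw [zero_add] at h₁
    rw [neg_add_cancel] at h₂
    simpa using (h₁.append (.single hb)).append h₂

theorem psiHom_injective {X : Type u} {idx : X → ℕ} (hidx : Function.Injective idx) :
    Function.Injective (psiHom idx) :=
  injective_of_reads (isFolded_psiEdge hidx) (exists_reads_psiHom idx)

theorem theorem3 {X : Type u} [Countable X]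
    (hX : ¬ ∀ x y : FreeGroup X, x * y = y * x) :
    (∃ φ₀ : FreeGroup X →* FreeGroup (Fin 2),
      Function.Injective φ₀ ∧ HasUniformFoldings.{u, v} φ₀) ∧
    ∀ idx : X → ℕ, Function.Injective idx → (∀ x, 1 ≤ idx x) →
      Function.Injective (squareCommHom.comp (psiHom idx)) ∧
      HasUniformFoldings.{u, v} (squareCommHom.comp (psiHom idx)) := by
  have h : ∀ idx : X → ℕ, Function.Injective idx →
      Function.Injective (squareCommHom.comp (psiHom idx)) ∧
      HasUniformFoldings.{u, v} (squareCommHom.comp (psiHom idx)) := fun idx hidx =>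
    ⟨squareCommHom_injective.comp (psiHom_injective hidx),
      hasUniformFoldings_squareCommHom_comp _⟩
  obtain ⟨idx, hidx⟩ := exists_injective_nat X
  exact ⟨⟨_, h idx hidx⟩, fun idx hidx _ => h idx hidx⟩
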